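/- There exist universal constants $0<c_1\le 4$ and $0<c_2\le 6$ such that the following holds. Let $D_i,M,L\ge 1$ and $D_o$ be natural numbers and let $\phi:\mathbb R\to\mathbb R$ be $1$-Lipschitz with constant even part, i.e. there is $\alpha\in\mathbb R$ with $\tfrac12(\phi(a)+\phi(-a))=\alpha$ for all $a$. Consider the fully connected network with $L$ hidden layers of width $M$, $$\mathbf z_1=\tfrac1{\sqrt{D_i}}\mathbf W_1\mathbf x+\mathbf b_1,\qquad \mathbf z_\ell=\tfrac1{\sqrt M}\mathbf W_\ell\,\phi(\mathbf z_{\ell-1})+\mathbf b_\ell\ (2\le \ell\le L),\qquad \mathbf f_\theta(\mathbf x)=\tfrac1{\sqrt M}\mathbf W_{L+1}\phi(\mathbf z_L)+\mathbf b_{L+1},$$ where $\mathbf x\in\mathbb R^{D_i}$, $\mathbf f_\theta(\mathbf x)\in\mathbb R^{D_o}$, $\phi$ is applied element-wise and $\theta$ is the vector of all entries of $\mathbf W_1,\mathbf b_1,\dots,\mathbf W_{L+1},\mathbf b_{L+1}$. Put $\widetilde{\mathbf f}_\theta(\mathbf x)=\mathbf f_\theta(\mathbf x)-\tfrac{\alpha}{\sqrt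 M}\mathbf W_{L+1}\mathbf 1-\mathbf b_{L+1}$. Let $P=\mathcal N(\mathbf 0,\mathbf I)$ be the prior on $\theta$, and let $Q=\mathcal N(\boldsymbol\mu,\operatorname{diag}(\boldsymbol\sigma^2))$, with arbitrary means and arbitrary positive variances, be a mean-field Gaussian distribution on $\theta$. Then $\mathrm{KL}(Q,P)<\infty$, the expectations below exist, and for all $\mathbf x\in\mathbb R^{D_i}$ $$\bigl\|\mathbb E_Q[\widetilde{\mathbf f}_\theta(\mathbf x)]\bigr\|_2\le c_1c_2^{L-1}L\,\frac{|\alpha|+1+\|\mathbf x\|_2/\sqrt{D_i}}{\sqrt M}\,\mathrm{KL}(Q,P)\Bigl((2\,\mathrm{KL}(Q,P))^{\frac{L-1}2}\vee 1\Bigr),$$ and, for all $\mathbf x,\mathbf x'\in\mathbb R^{D_i}$ $$\bigl\|\mathbb E_Q[\mathbf f_\theta(\mathbf x)]-\mathbb E_Q[\mathbf f_\theta(\mathbf x')]\bigr\|_2\le c_1c_2^{L-1}L\,\frac{2|\alpha|+2+(\|\mathbf x\|_2+\|\mathbf x'\|_2)/\sqrt{D_i}}{\sqrt M}\,\mathrm{KL}(Q,P)\Bigl((2\,\mathrm{KL}(Q,P))^{\frac{L-1}2}\vee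 1\Bigr),$$ where $a\vee b=\max(a,b)$. -/

import Mathlib

namespace MeanFieldBNN

/-- One index for each scalar parameter of a fully connected network with input dimension `Di`,
`L ≥ 1` hidden layers of width `M`, and output dimension `Do`.
The weights and biases of hidden layers `2, …, L` are indexed by `ℓ : Fin (L - 1)`,
where `ℓ` stands for hidden layer number `ℓ + 2`. -/
inductive ParamIdx (Di M Do L : ℕ) : Type
  | inputWeight (i : Fin M) (j : Fin Di)
  | inputBias (i : Fin M)
  | hiddenWeight (ℓ : Fin (L - 1)) (i j : Fin M)
  | hiddenBias (ℓ : Fin (L - 1)) (i : Fin M)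
  | outputWeight (i : Fin Do) (j : Fin M)
  | outputBias (i : Fin Do)
  deriving DecidableEq, Fintype

/-- The concatenation `θ` of all parameters of the network. -/
abbrev Params (Di M Do L : ℕ) : Type := ParamIdx Di M Do L → ℝ

section Network

variable {Di M Do L : ℕ}

/-- `W₁` -/
def Params.inputWeight (θ : Params Di M Do L) : Matrix (Fin M) (Fin Di) ℝ :=
  Matrix.of fun i j => θ (ParamIdx.inputWeight i j)

/-- `b₁` -/
def Params.inputBias (θ : Params Di M Do L) : Fin M → ℝ :=
  fun i => θ (ParamIdx.inputBias i)

/-- `W_{ℓ+2}` -/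
def Params.hiddenWeight (θ : Params Di M Do L) (ℓ : Fin (L - 1)) : Matrix (Fin M) (Fin M) ℝ :=
  Matrix.of fun i j => θ (ParamIdx.hiddenWeight ℓ i j)

/-- `b_{ℓ+2}` -/
def Params.hiddenBias (θ : Params Di M Do L) (ℓ : Fin (L - 1)) : Fin M → ℝ :=
  fun i => θ (ParamIdx.hiddenBias ℓ i)

/-- `W_{L+1}` -/
def Params.outputWeight (θ : Params Di M Do L) : Matrix (Fin Do) (Fin M) ℝ :=
  Matrix.of fun i j => θ (ParamIdx.outputWeight i j)

/-- `b_{L+1}` -/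
def Params.outputBias (θ : Params Di M Do L) : Fin Do → ℝ :=
  fun i => θ (ParamIdx.outputBias i)

/-- The preactivations: `preact φ θ x ℓ _` is `z_{ℓ+1}(x)`, where
`z₁ = W₁ x / √Di + b₁` and `z_l = W_l φ(z_{l-1}) / √M + b_l` for `2 ≤ l ≤ L`. -/
noncomputable def preact (φ : ℝ → ℝ) (θ : Params Di M Do L) (x : EuclideanSpace ℝ (Fin Di)) :
    (ℓ : ℕ) → ℓ ≤ L - 1 → Fin M → ℝ
  | 0, _ => (1 / √(Di : ℝ)) • θ.inputWeight.mulVec (fun j => x j) + θ.inputBias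
  | ℓ + 1, h =>
      (1 / √(M : ℝ)) • (θ.hiddenWeight ⟨ℓ, h⟩).mulVec
          (fun j => φ (preact φ θ x ℓ (Nat.le_of_succ_le h) j))
        + θ.hiddenBias ⟨ℓ, h⟩

/-- The network output `f_θ(x) = W_{L+1} φ(z_L(x)) / √M + b_{L+1}`. -/
noncomputable def network (φ : ℝ → ℝ) (θ : Params Di M Do L) (x : EuclideanSpace ℝ (Fin Di)) :
    EuclideanSpace ℝ (Fin Do) :=
  WithLp.toLp 2
    ((1 / √(M : ℝ)) • θ.outputWeight.mulVec (fun j => φ (preact φ θ x (L - 1) le_rfl j))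
      + θ.outputBias)

/-- The network output without the final bias and without the contribution of the constant
even part `α` of the final activation: `f_θ(x) - (α / √M) W_{L+1} 1 - b_{L+1}`. -/
noncomputable def networkTilde (φ : ℝ → ℝ) (α : ℝ) (θ : Params Di M Do L)
    (x : EuclideanSpace ℝ (Fin Di)) : EuclideanSpace ℝ (Fin Do) :=
  network φ θ x
    - WithLp.toLp 2 ((α / √(M : ℝ)) • θ.outputWeight.mulVec (fun _ => (1 : ℝ)))
    - WithLp.toLp 2 θ.outputBias

end Network

/-- The even part of a function on the real line. -/
noncomputable def evenPart (φ : ℝ → ℝ) : ℝ → ℝ := fun a => (φ a + φ (-a)) / 2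

/-- The factorized Gaussian distribution with means `m` and variances `v`. -/
noncomputable def diagGaussian {Di M Do L : ℕ} (m : ParamIdx Di M Do L → ℝ)
    (v : ParamIdx Di M Do L → NNReal) : MeasureTheory.Measure (Params Di M Do L) :=
  MeasureTheory.Measure.pi fun i => ProbabilityTheory.gaussianReal (m i) (v i)

/-- The prior: independent standard Gaussians. -/
noncomputable def prior (Di M Do L : ℕ) : MeasureTheory.Measure (Params Di M Do L) :=
  diagGaussian (fun _ => 0) (fun _ => 1)

/-- Membership in the mean-field family: a factorized Gaussian with positive variances. -/
def IsMeanFieldGaussian {Di M Do L : ℕ}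
    (Q : MeasureTheory.Measure (Params Di M Do L)) : Prop :=
  ∃ (m : ParamIdx Di M Do L → ℝ) (v : ParamIdx Di M Do L → NNReal),
    (∀ i, 0 < v i) ∧ Q = diagGaussian m v

/-- The Kullback-Leibler divergence from `Q` to the prior, as a real number. -/
noncomputable def klPrior {Di M Do L : ℕ}
    (Q : MeasureTheory.Measure (Params Di M Do L)) : ℝ :=
  (InformationTheory.klDiv Q (prior Di M Do L)).toReal

end MeanFieldBNN

/-! Write `K² = 2 KL(Q, P)`. The divergence splits over coordinates, and `v - 1 - log v ≥ (√v -
1)²`, so `∑ (m² + (√v - 1)²) ≤ K²` (`sum_sq_add_sum_sq_le_klDiv`): means and standard deviations are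
`K`-close in `ℓ²` to those of the prior, whatever the number of parameters.

A preactivation is a linear form in its layer's own weights whose coefficients depend only on
earlier layers, hence are independent of those weights. If these coefficients have total second
moment at most `G²`, the preactivations of the layer have total second moment at most `M ((1 + K)
G)²`.

The expectation of `ψ = φ - α`, which is odd and 1-Lipschitz, is much smaller. Reflecting the
layer's weights at their means preserves `Q` and sends `z` to `2a - z`, where `a` is the linear form
with the mean weights; oddness and Lipschitz continuity then give `|E ψ(z)| ≤ E |a|`
(`sq_integral_comp_linForm_le`). Thus the vector of these expectations has norm at most `K G`.

In the output layer the mean weights contribute a second factor `K`, and the vector is divided by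
`√M` without `√M` terms to compensate. This yields `K² G / √M` with `G = L (1 + K)^(L-1) S` and `S =
|α| + 1 + ‖x‖/√Di`. -/

open MeasureTheory ProbabilityTheory InformationTheory
open scoped NNReal ENNReal

namespace MeanFieldBNN

/-! ### Divergence of a factorized Gaussian from the standard one. -/

section KullbackLeibler

/-- The log-likelihood ratio of `𝒩(m, v)` with respect to `𝒩(0, 1)`. -/
noncomputable def gaussianLogRatio (m : ℝ) (v : ℝ≥0) (x : ℝ) : ℝ :=
  x ^ 2 / 2 - (x - m) ^ 2 / (2 * v) - Real.log v / 2

lemma measurable_gaussianLogRatio (m : ℝ) (v : ℝ≥0) : Measurable (gaussianLogRatio m v) := by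
  unfold gaussianLogRatio; fun_prop

lemma gaussianPDFReal_eq_mul_exp_logRatio (m : ℝ) {v : ℝ≥0} (hv : 0 < v) (x : ℝ) :
    gaussianPDFReal m v x = gaussianPDFReal 0 1 x * Real.exp (gaussianLogRatio m v x) := by
  have hv' : (0 : ℝ) < v := hv
  have hsqrt : (√(v : ℝ))⁻¹ = Real.exp (-(Real.log v / 2)) := by
    rw [Real.exp_neg, ← Real.log_sqrt hv'.le, Real.exp_log (Real.sqrt_pos.2 hv')]
  rw [gaussianPDFReal, gaussianPDFReal, Real.sqrt_mul (by positivity) (v : ℝ), mul_inv, hsqrt]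
  simp only [NNReal.coe_one, mul_one, sub_zero]
  rw [mul_assoc, mul_assoc, ← Real.exp_add, ← Real.exp_add, gaussianLogRatio]
  congr 2
  ring

lemma gaussianReal_eq_withDensity_exp (m : ℝ) {v : ℝ≥0} (hv : 0 < v) :
    gaussianReal m v
      = (gaussianReal 0 1).withDensity fun x => ENNReal.ofReal (Real.exp (gaussianLogRatio m v x)) := by
  have hmeas := measurable_gaussianLogRatio m v
  rw [gaussianReal_of_var_ne_zero m hv.ne', gaussianReal_of_var_ne_zero 0 one_ne_zero,
    ← withDensity_mul _ (measurable_gaussianPDF 0 1) (by fun_prop)]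
  congr 1
  ext x
  rw [Pi.mul_apply, gaussianPDF, gaussianPDF, gaussianPDFReal_eq_mul_exp_logRatio m hv,
    ENNReal.ofReal_mul (gaussianPDFReal_nonneg _ _ _)]

lemma memLp_two_gaussianReal (m : ℝ) (v : ℝ≥0) : MemLp (fun x => x) 2 (gaussianReal m v) :=
  memLp_id_gaussianReal' 2 (by simp)

lemma integral_sq_gaussianReal (m : ℝ) (v : ℝ≥0) :
    ∫ x, x ^ 2 ∂gaussianReal m v = m ^ 2 + v := by
  have h := variance_eq_sub (memLp_two_gaussianReal m v)
  rw [variance_fun_id_gaussianReal, integral_id_gaussianReal] at h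
  simp only [Pi.pow_apply] at h
  linarith

lemma integral_sub_mean_sq_gaussianReal (m : ℝ) (v : ℝ≥0) :
    ∫ x, (x - m) ^ 2 ∂gaussianReal m v = v := by
  have h := variance_eq_integral (μ := gaussianReal m v) (X := fun x => x) (by fun_prop)
  rw [variance_fun_id_gaussianReal, integral_id_gaussianReal] at h
  exact h.symm

lemma integrable_gaussianLogRatio (m : ℝ) (v : ℝ≥0) :
    Integrable (gaussianLogRatio m v) (gaussianReal m v) := by
  have h := memLp_two_gaussianReal m v
  exact ((h.integrable_sq.div_const 2).sub
    ((h.sub (memLp_const m)).integrable_sq.div_const (2 * v))).sub (integrable_const _)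

lemma integral_gaussianLogRatio (m : ℝ) {v : ℝ≥0} (hv : 0 < v) :
    ∫ x, gaussianLogRatio m v x ∂gaussianReal m v = (m ^ 2 + (v - 1 - Real.log v)) / 2 := by
  have hv' : (v : ℝ) ≠ 0 := by exact_mod_cast hv.ne'
  have h := memLp_two_gaussianReal m v
  have h₁ := h.integrable_sq.div_const 2
  have h₂ : Integrable (fun x => (x - m) ^ 2 / (2 * v)) (gaussianReal m v) :=
    (h.sub (memLp_const m)).integrable_sq.div_const (2 * v)
  have h₃ : Integrable (fun x => x ^ 2 / 2 - (x - m) ^ 2 / (2 * v)) (gaussianReal m v) :=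
    h₁.sub h₂
  unfold gaussianLogRatio
  rw [integral_sub h₃ (integrable_const _), integral_sub h₁ h₂, integral_div,
    integral_div, integral_sq_gaussianReal, integral_sub_mean_sq_gaussianReal]
  simp only [integral_const, probReal_univ, one_smul]
  field_simp
  ring

variable {ι : Type*} [Fintype ι]

/-- It suffices to compare boxes; there independence of the coordinates turns the integral of the
product into a product of integrals. -/
lemma pi_withDensity {X : ι → Type*} [∀ i, MeasurableSpace (X i)] (ν : ∀ i, Measure (X i))
    [∀ i, IsProbabilityMeasure (ν i)] (g : ∀ i, X i → ℝ≥0∞) (hg : ∀ i, Measurable (g i))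
    [∀ i, SigmaFinite ((ν i).withDensity (g i))] :
    Measure.pi (fun i => (ν i).withDensity (g i))
      = (Measure.pi ν).withDensity fun x => ∏ i, g i (x i) := by
  refine Measure.pi_eq fun s hs => ?_
  have hind : iIndepFun (fun i (x : ∀ i, X i) => (s i).indicator (g i) (x i)) (Measure.pi ν) :=
    iIndepFun_pi fun i => ((hg i).indicator (hs i)).aemeasurable
  have hprod := lintegral_prod_eq_prod_lintegral_of_indepFun Finset.univ _ hind
    fun i => ((hg i).indicator (hs i)).comp (measurable_pi_apply i)
  rw [withDensity_apply _ (MeasurableSet.univ_pi hs),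
    ← lintegral_indicator (MeasurableSet.univ_pi hs)]
  convert hprod using 1
  · refine lintegral_congr fun x => ?_
    by_cases hx : ∀ i, x i ∈ s i
    · rw [Set.indicator_of_mem (by simpa using hx)]
      exact Finset.prod_congr rfl fun i _ => (Set.indicator_of_mem (hx i) _).symm
    · rw [Set.indicator_of_notMem (by simpa using hx)]
      obtain ⟨i, hi⟩ := not_forall.1 hx
      exact (Finset.prod_eq_zero (Finset.mem_univ i) (Set.indicator_of_notMem hi _)).symm
  · refine Finset.prod_congr rfl fun i _ => ?_
    rw [withDensity_apply _ (hs i), ← lintegral_indicator (hs i),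
      ← (measurePreserving_eval ν i).lintegral_comp ((hg i).indicator (hs i))]

lemma pi_gaussianReal_eq_withDensity (m : ι → ℝ) {v : ι → ℝ≥0} (hv : ∀ i, 0 < v i) :
    Measure.pi (fun i => gaussianReal (m i) (v i))
      = (Measure.pi fun _ : ι => gaussianReal 0 1).withDensity fun x =>
          ENNReal.ofReal (Real.exp (∑ i, gaussianLogRatio (m i) (v i) (x i))) := by
  have h := fun i => gaussianReal_eq_withDensity_exp (m i) (hv i)
  have : ∀ i, SigmaFinite ((gaussianReal 0 1).withDensity
      fun x => ENNReal.ofReal (Real.exp (gaussianLogRatio (m i) (v i) x))) :=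
    fun i => h i ▸ inferInstance
  rw [funext h, pi_withDensity]
  · congr 1
    ext x
    rw [Real.exp_sum, ENNReal.ofReal_prod_of_nonneg fun i _ => (Real.exp_pos _).le]
  · exact fun i => (measurable_gaussianLogRatio _ _).exp.ennreal_ofReal

lemma llr_pi_gaussianReal (m : ι → ℝ) {v : ι → ℝ≥0} (hv : ∀ i, 0 < v i) :
    llr (Measure.pi fun i => gaussianReal (m i) (v i)) (Measure.pi fun _ : ι => gaussianReal 0 1)
      =ᵐ[Measure.pi fun i => gaussianReal (m i) (v i)]
        fun x => ∑ i, gaussianLogRatio (m i) (v i) (x i) := by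
  have hm : Measurable fun x : ι → ℝ =>
      ENNReal.ofReal (Real.exp (∑ i, gaussianLogRatio (m i) (v i) (x i))) :=
    (Finset.measurable_sum _ fun i _ =>
      (measurable_gaussianLogRatio _ _).comp (measurable_pi_apply i)).exp.ennreal_ofReal
  rw [pi_gaussianReal_eq_withDensity m hv]
  refine (withDensity_absolutelyContinuous _ _).ae_eq ?_
  filter_upwards [Measure.rnDeriv_withDensity (Measure.pi fun _ : ι => gaussianReal 0 1) hm]
    with x hx
  rw [llr, hx, ENNReal.toReal_ofReal (Real.exp_pos _).le, Real.log_exp]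

lemma absolutelyContinuous_pi_gaussianReal (m : ι → ℝ) {v : ι → ℝ≥0} (hv : ∀ i, 0 < v i) :
    (Measure.pi fun i => gaussianReal (m i) (v i)) ≪ Measure.pi fun _ : ι => gaussianReal 0 1 := by
  rw [pi_gaussianReal_eq_withDensity m hv]
  exact withDensity_absolutelyContinuous _ _

lemma klDiv_pi_gaussianReal_ne_top (m : ι → ℝ) {v : ι → ℝ≥0} (hv : ∀ i, 0 < v i) :
    klDiv (Measure.pi fun i => gaussianReal (m i) (v i))
      (Measure.pi fun _ : ι => gaussianReal 0 1) ≠ ∞ := by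
  refine klDiv_ne_top (absolutelyContinuous_pi_gaussianReal m hv) ?_
  rw [integrable_congr (llr_pi_gaussianReal m hv)]
  exact integrable_finsetSum _ fun i _ => integrable_comp_eval (integrable_gaussianLogRatio _ _)

lemma toReal_klDiv_pi_gaussianReal (m : ι → ℝ) {v : ι → ℝ≥0} (hv : ∀ i, 0 < v i) :
    (klDiv (Measure.pi fun i => gaussianReal (m i) (v i))
      (Measure.pi fun _ : ι => gaussianReal 0 1)).toReal
      = ∑ i, (m i ^ 2 + (v i - 1 - Real.log (v i))) / 2 := by
  rw [toReal_klDiv_of_measure_eq (absolutelyContinuous_pi_gaussianReal m hv) (by simp),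
    integral_congr_ae (llr_pi_gaussianReal m hv), integral_finsetSum]
  · refine Finset.sum_congr rfl fun i _ => ?_
    rw [integral_comp_eval (measurable_gaussianLogRatio _ _).aestronglyMeasurable,
      integral_gaussianLogRatio _ (hv i)]
  · exact fun i _ => integrable_comp_eval (integrable_gaussianLogRatio _ _)

/-- Apply `log s ≤ s - 1` to `s = √v`, so that `log v ≤ 2 (√v - 1)`. -/
lemma sqrt_sub_one_sq_le {v : ℝ} (hv : 0 < v) : (√v - 1) ^ 2 ≤ v - 1 - Real.log v := by
  have h := Real.log_le_sub_one_of_pos (Real.sqrt_pos.2 hv)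
  rw [Real.log_sqrt hv.le] at h
  nlinarith [Real.sq_sqrt hv.le]

/-- The parameters of a factorized Gaussian are close to those of the standard Gaussian when the
Kullback-Leibler divergence is small. -/
lemma sum_sq_add_sum_sq_le_klDiv (m : ι → ℝ) {v : ι → ℝ≥0} (hv : ∀ i, 0 < v i) :
    ∑ i, (m i ^ 2 + (√(v i : ℝ) - 1) ^ 2)
      ≤ 2 * (klDiv (Measure.pi fun i => gaussianReal (m i) (v i))
        (Measure.pi fun _ : ι => gaussianReal 0 1)).toReal := by
  rw [toReal_klDiv_pi_gaussianReal m hv, Finset.mul_sum]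
  refine Finset.sum_le_sum fun i _ => ?_
  have := sqrt_sub_one_sq_le (v := v i) (by exact_mod_cast hv i)
  linarith

end KullbackLeibler

/-! ### Linear forms in Gaussian weights with independent random coefficients. -/

section Moments

lemma sq_integral_le_integral_sq {Ω : Type*} [MeasurableSpace Ω] {P : Measure Ω}
    [IsProbabilityMeasure P] {f : Ω → ℝ} (hf : MemLp f 2 P) :
    (∫ ω, f ω ∂P) ^ 2 ≤ ∫ ω, f ω ^ 2 ∂P := by
  have h := variance_nonneg f P
  rw [variance_eq_sub hf] at h
  simp only [Pi.pow_apply] at h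
  linarith

lemma integral_sum_mul_sq_le {Ω κ : Type*} [MeasurableSpace Ω] [Fintype κ] {P : Measure Ω}
    (a : κ → ℝ) {H : κ → Ω → ℝ} (hH : ∀ o, MemLp (H o) 2 P) :
    ∫ ω, (∑ o, a o * H o ω) ^ 2 ∂P ≤ (∑ o, a o ^ 2) * ∑ o, ∫ ω, H o ω ^ 2 ∂P := by
  rw [← integral_finsetSum _ fun o _ => (hH o).integrable_sq, ← integral_const_mul]
  refine integral_mono ?_ ?_ fun ω => Finset.sum_mul_sq_le_sq_mul_sq _ _ _
  · exact (memLp_finsetSum _ fun o _ => (hH o).const_mul (a o)).integrable_sq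
  · exact (integrable_finsetSum _ fun o _ => (hH o).integrable_sq).const_mul _

lemma sum_comp_le_sum {α ι : Type*} [Fintype α] [Fintype ι] {e : α → ι}
    (he : Function.Injective e) {f : ι → ℝ} (hf : ∀ i, 0 ≤ f i) : ∑ a, f (e a) ≤ ∑ i, f i :=
  (Finset.sum_map Finset.univ ⟨e, he⟩ f).symm.trans_le
    (Finset.sum_le_univ_sum_of_nonneg hf)

variable {ι κ : Type*} [Fintype ι] [Fintype κ]

lemma indepFun_of_dependsOn {β : Type*} [MeasurableSpace β] (P : ι → Measure ℝ)
    [∀ i, IsProbabilityMeasure (P i)] (e : κ → ι) {G : (ι → ℝ) → β} (hG : Measurable G)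
    (hdep : DependsOn G (Set.range e)ᶜ) :
    IndepFun (fun θ o => θ (e o)) G (Measure.pi P) := by
  classical
  set S : Finset ι := Finset.univ.image e with hS
  have hmem : ∀ o, e o ∈ S := fun o => Finset.mem_image_of_mem e (Finset.mem_univ o)
  have hind : iIndepFun (fun i (θ : ι → ℝ) => θ i) (Measure.pi P) :=
    iIndepFun_pi (X := fun _ x => x) fun i => aemeasurable_id
  have h := hind.indepFun_finset S Sᶜ disjoint_compl_right fun i => measurable_pi_apply i
  have h₁ : Measurable fun (y : S → ℝ) (o : κ) => y ⟨e o, hmem o⟩ := by fun_prop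
  -- Coordinates in the range of `e` are filled with `0`; `G` does not see them, so it factors
  -- through the complementary block.
  have h₂ : Measurable fun (y : (Sᶜ : Finset ι) → ℝ) (i : ι) =>
      if hi : i ∈ Sᶜ then y ⟨i, hi⟩ else 0 := by
    refine measurable_pi_lambda _ fun i => ?_
    by_cases hi : i ∈ Sᶜ
    · simp only [hi, dite_true]; fun_prop
    · simp only [hi, dite_false]; fun_prop
  refine (h.comp h₁ (hG.comp h₂)).congr (.of_forall fun θ => rfl)
    (.of_forall fun θ => hdep fun i hi => ?_)
  have : i ∈ Sᶜ := by simpa [hS] using hi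
  simp [this]

variable {m : ι → ℝ} {v : ι → ℝ≥0}

lemma memLp_eval (i : ι) :
    MemLp (fun θ : ι → ℝ => θ i) 2 (Measure.pi fun i => gaussianReal (m i) (v i)) :=
  (memLp_two_gaussianReal (m i) (v i)).comp_measurePreserving
    (measurePreserving_eval (fun i => gaussianReal (m i) (v i)) i)

lemma integral_eval_eq (i : ι) :
    ∫ θ, θ i ∂Measure.pi (fun i => gaussianReal (m i) (v i)) = m i := by
  rw [integral_eval, integral_id_gaussianReal]

lemma integral_eval_mul_eval [DecidableEq ι] (i j : ι) :
    ∫ θ, θ i * θ j ∂Measure.pi (fun i => gaussianReal (m i) (v i))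
      = m i * m j + if i = j then (v i : ℝ) else 0 := by
  split_ifs with h
  · subst h
    simp_rw [← sq]
    rw [integral_comp_eval (μ := fun i => gaussianReal (m i) (v i)) (f := fun x => x ^ 2)
      (by fun_prop), integral_sq_gaussianReal]
  · have hind : iIndepFun (fun i (θ : ι → ℝ) => θ i)
        (Measure.pi fun i => gaussianReal (m i) (v i)) :=
      iIndepFun_pi (X := fun _ x => x) fun i => aemeasurable_id
    rw [(hind.indepFun h).integral_fun_mul_eq_mul_integral (memLp_eval i).1 (memLp_eval j).1,
      integral_eval_eq, integral_eval_eq, add_zero]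

/-- A linear form in the coordinates indexed by `e`, with random coefficients `H`. -/
def linForm (e : κ → ι) (H : κ → (ι → ℝ) → ℝ) (θ : ι → ℝ) : ℝ := ∑ o, θ (e o) * H o θ

lemma memLp_eval_mul {e : κ → ι} {G : (ι → ℝ) → ℝ} (hmeas : Measurable G)
    (hG : MemLp G 2 (Measure.pi fun i => gaussianReal (m i) (v i)))
    (hdep : DependsOn G (Set.range e)ᶜ) (o : κ) :
    MemLp (fun θ => θ (e o) * G θ) 2 (Measure.pi fun i => gaussianReal (m i) (v i)) := by
  have hind := (indepFun_of_dependsOn (fun i => gaussianReal (m i) (v i)) e hmeas hdep).comp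
    (φ := fun y => y o ^ 2) (ψ := fun x => x ^ 2) (by fun_prop) (by fun_prop)
  refine (memLp_two_iff_integrable_sq (by fun_prop)).2 ?_
  refine (hind.integrable_mul (memLp_eval (e o)).integrable_sq hG.integrable_sq).congr ?_
  exact .of_forall fun θ => (mul_pow _ _ _).symm

lemma integral_eval_mul {e : κ → ι} {G : (ι → ℝ) → ℝ} (hmeas : Measurable G)
    (hdep : DependsOn G (Set.range e)ᶜ) (o : κ) :
    ∫ θ, θ (e o) * G θ ∂Measure.pi (fun i => gaussianReal (m i) (v i))
      = m (e o) * ∫ θ, G θ ∂Measure.pi (fun i => gaussianReal (m i) (v i)) := by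
  have hind := (indepFun_of_dependsOn (fun i => gaussianReal (m i) (v i)) e hmeas hdep).comp
    (measurable_pi_apply o : Measurable fun y : κ → ℝ => y o) measurable_id
  have h := hind.integral_mul_eq_mul_integral (memLp_eval (e o)).1
    hmeas.aestronglyMeasurable
  rw [← integral_eval_eq (m := m) (v := v) (e o)]
  exact h

lemma memLp_linForm {e : κ → ι} {H : κ → (ι → ℝ) → ℝ} (hmeas : ∀ o, Measurable (H o))
    (hH : ∀ o, MemLp (H o) 2 (Measure.pi fun i => gaussianReal (m i) (v i)))
    (hdep : ∀ o, DependsOn (H o) (Set.range e)ᶜ) :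
    MemLp (linForm e H) 2 (Measure.pi fun i => gaussianReal (m i) (v i)) :=
  memLp_finsetSum _ fun o _ => memLp_eval_mul (hmeas o) (hH o) (hdep o) o

/-- Expand the square and factor each term by independence. Injectivity of `e` makes distinct
weights uncorrelated, so variances enter only on the diagonal. -/
lemma integral_linForm_sq {e : κ → ι} (he : Function.Injective e) {H : κ → (ι → ℝ) → ℝ}
    (hmeas : ∀ o, Measurable (H o))
    (hH : ∀ o, MemLp (H o) 2 (Measure.pi fun i => gaussianReal (m i) (v i)))
    (hdep : ∀ o, DependsOn (H o) (Set.range e)ᶜ) :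
    ∫ θ, linForm e H θ ^ 2 ∂Measure.pi (fun i => gaussianReal (m i) (v i))
      = ∫ θ, (∑ o, m (e o) * H o θ) ^ 2 ∂Measure.pi (fun i => gaussianReal (m i) (v i))
        + ∑ o, v (e o) * ∫ θ, H o θ ^ 2 ∂Measure.pi (fun i => gaussianReal (m i) (v i)) := by
  classical
  set Q := Measure.pi fun i => gaussianReal (m i) (v i) with hQ
  have hterm : ∀ o p, ∫ θ, (θ (e o) * H o θ) * (θ (e p) * H p θ) ∂Q
      = (m (e o) * m (e p) + if o = p then (v (e o) : ℝ) else 0) * ∫ θ, H o θ * H p θ ∂Q := by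
    intro o p
    have hdep' : DependsOn (fun θ => H o θ * H p θ) (Set.range e)ᶜ := fun x y hxy => by
      simp only [hdep o hxy, hdep p hxy]
    have hind := (indepFun_of_dependsOn (fun i => gaussianReal (m i) (v i)) e
      ((hmeas o).mul (hmeas p)) hdep').comp
      (φ := fun y => y o * y p) (ψ := fun x => x) (by fun_prop) (by fun_prop)
    have h := hind.integral_mul_eq_mul_integral (by fun_prop) (by fun_prop)
    have h' := integral_eval_mul_eval (m := m) (v := v) (e o) (e p)
    rw [if_congr he.eq_iff rfl rfl] at h'
    rw [← h', ← hQ]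
    refine Eq.trans (integral_congr_ae (.of_forall fun θ => ?_)) h
    simp only [Pi.mul_apply, Function.comp_apply]
    ring
  have hint₁ : ∀ o p, Integrable (fun θ => (θ (e o) * H o θ) * (θ (e p) * H p θ)) Q := fun o p =>
    (memLp_eval_mul (hmeas o) (hH o) (hdep o) o).integrable_mul
      (memLp_eval_mul (hmeas p) (hH p) (hdep p) p)
  have hint₂ : ∀ o p, Integrable (fun θ => (m (e o) * H o θ) * (m (e p) * H p θ)) Q := fun o p =>
    ((hH o).const_mul _).integrable_mul ((hH p).const_mul _)
  simp only [linForm, sq, Finset.sum_mul_sum]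
  rw [integral_finsetSum _ fun o _ => integrable_finsetSum _ fun p _ => hint₁ o p,
    integral_finsetSum _ fun o _ => integrable_finsetSum _ fun p _ => hint₂ o p,
    ← Finset.sum_add_distrib]
  refine Finset.sum_congr rfl fun o _ => ?_
  rw [integral_finsetSum _ fun p _ => hint₁ o p, integral_finsetSum _ fun p _ => hint₂ o p]
  simp only [hterm, add_mul, Finset.sum_add_distrib, ite_mul, zero_mul, Finset.sum_ite_eq,
    Finset.mem_univ, if_true]
  congr 1
  refine Finset.sum_congr rfl fun p _ => ?_
  rw [← integral_const_mul]
  congr 1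
  ext θ
  ring

/-- Minkowski's inequality for `√w = 1 + (√w - 1)`, with room for an extra term `N`, to be filled by
the squared means. -/
lemma sum_variance_le {ρ : Type*} [Fintype ρ] {w : ρ → ℝ≥0} {K N : ℝ} (hK : 0 ≤ K)
    (h : N + ∑ i, (√(w i : ℝ) - 1) ^ 2 ≤ K ^ 2) (hN : 0 ≤ N) :
    N + ∑ i, (w i : ℝ) ≤ (√(Fintype.card ρ : ℝ) + K) ^ 2 := by
  have hcs := sq_sum_le_card_mul_sum_sq (s := Finset.univ) (f := fun i => √(w i : ℝ) - 1)
  rw [Finset.card_univ] at hcs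
  have hlin : ∑ i, (√(w i : ℝ) - 1) ≤ √(Fintype.card ρ : ℝ) * K := by
    refine le_of_sq_le_sq ?_ (by positivity)
    rw [mul_pow, Real.sq_sqrt (Nat.cast_nonneg _)]
    refine hcs.trans (mul_le_mul_of_nonneg_left ?_ (Nat.cast_nonneg _))
    linarith
  have hexp : ∑ i, (w i : ℝ)
      = Fintype.card ρ + 2 * ∑ i, (√(w i : ℝ) - 1) + ∑ i, (√(w i : ℝ) - 1) ^ 2 := by
    rw [Finset.mul_sum, ← nsmul_one, ← Finset.card_univ, ← Finset.sum_const,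
      ← Finset.sum_add_distrib, ← Finset.sum_add_distrib]
    refine Finset.sum_congr rfl fun i _ => ?_
    nlinarith [Real.sq_sqrt (w i).coe_nonneg]
  nlinarith [Real.sq_sqrt (Nat.cast_nonneg (Fintype.card ρ) : (0 : ℝ) ≤ Fintype.card ρ)]

/-- The second moment of the output of a random affine layer whose weights are independent of its
input. -/
lemma sum_integral_linForm_sq_le {ρ : Type*} [Fintype ρ] {e : ρ × κ → ι}
    (he : Function.Injective e) {H : κ → (ι → ℝ) → ℝ} (hmeas : ∀ o, Measurable (H o))
    (hH : ∀ o, MemLp (H o) 2 (Measure.pi fun i => gaussianReal (m i) (v i)))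
    (hdep : ∀ o, DependsOn (H o) (Set.range e)ᶜ) {K : ℝ} (hK : 0 ≤ K)
    (hmv : ∑ i, (m i ^ 2 + (√(v i : ℝ) - 1) ^ 2) ≤ K ^ 2) :
    ∑ i, ∫ θ, linForm (fun o => e (i, o)) H θ ^ 2 ∂Measure.pi (fun i => gaussianReal (m i) (v i))
      ≤ (√(Fintype.card ρ : ℝ) + K) ^ 2
        * ∑ o, ∫ θ, H o θ ^ 2 ∂Measure.pi (fun i => gaussianReal (m i) (v i)) := by
  set Q := Measure.pi fun i => gaussianReal (m i) (v i) with hQ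
  have hrow : ∀ i, ∫ θ, linForm (fun o => e (i, o)) H θ ^ 2 ∂Q
      ≤ (∑ o, m (e (i, o)) ^ 2) * ∑ o, ∫ θ, H o θ ^ 2 ∂Q
        + ∑ o, v (e (i, o)) * ∫ θ, H o θ ^ 2 ∂Q := fun i => by
    rw [hQ, integral_linForm_sq (e := fun o => e (i, o))
      (he.comp (Prod.mk_right_injective i)) hmeas hH fun o =>
      (hdep o).mono (Set.compl_subset_compl.2 (by rintro _ ⟨p, rfl⟩; exact ⟨_, rfl⟩))]
    gcongr
    exact integral_sum_mul_sq_le _ hH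
  refine (Finset.sum_le_sum fun i _ => hrow i).trans ?_
  have hswap : ∑ i, ∑ o, v (e (i, o)) * ∫ θ, H o θ ^ 2 ∂Q
      = ∑ o, ∑ i, v (e (i, o)) * ∫ θ, H o θ ^ 2 ∂Q := Finset.sum_comm
  rw [Finset.sum_add_distrib, ← Finset.sum_mul, hswap, Finset.mul_sum,
    Finset.mul_sum, ← Finset.sum_add_distrib]
  -- The coefficient of `E H_o²` contains all squared means but only the variances of column `o`, so
  -- the square root is of the number of rows, not of the number of weights.
  refine Finset.sum_le_sum fun o _ => ?_
  rw [← Finset.sum_mul, ← add_mul]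
  refine mul_le_mul_of_nonneg_right (sum_variance_le hK ?_ ?_) (integral_nonneg fun _ => sq_nonneg _)
  · refine le_trans ?_ ((sum_comp_le_sum he fun i => by positivity).trans hmv)
    rw [Fintype.sum_prod_type, ← Finset.sum_add_distrib]
    refine Finset.sum_le_sum fun i _ => ?_
    rw [Finset.sum_add_distrib]
    gcongr
    exact Finset.single_le_sum (f := fun o => (√(v (e (i, o)) : ℝ) - 1) ^ 2)
      (fun o _ => sq_nonneg _) (Finset.mem_univ o)
  · positivity

open scoped Classical in
/-- Reflection of the coordinates in `s` at the mean `m`. -/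
noncomputable def reflect (m : ι → ℝ) (s : Set ι) (θ : ι → ℝ) (i : ι) : ℝ :=
  if i ∈ s then 2 * m i - θ i else θ i

lemma measurePreserving_reflect (s : Set ι) :
    MeasurePreserving (reflect m s) (Measure.pi fun i => gaussianReal (m i) (v i))
      (Measure.pi fun i => gaussianReal (m i) (v i)) := by
  classical
  refine measurePreserving_pi (f := fun i x => if i ∈ s then 2 * m i - x else x) _ _ fun i => ?_
  by_cases hi : i ∈ s
  · simp only [hi, if_true]
    refine ⟨by fun_prop, ?_⟩
    rw [gaussianReal_map_const_sub]
    congr 1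
    ring
  · simp only [hi, if_false]
    exact MeasurePreserving.id _

/-- Only the mean of the weights contributes to the expectation of an odd function of a linear
form. -/
lemma sq_integral_comp_linForm_le {e : κ → ι} {H : κ → (ι → ℝ) → ℝ}
    (hmeas : ∀ o, Measurable (H o))
    (hH : ∀ o, MemLp (H o) 2 (Measure.pi fun i => gaussianReal (m i) (v i)))
    (hdep : ∀ o, DependsOn (H o) (Set.range e)ᶜ) {ψ : ℝ → ℝ} (hψ : LipschitzWith 1 ψ)
    (hodd : ∀ a, ψ (-a) = -ψ a) :
    (∫ θ, ψ (linForm e H θ) ∂Measure.pi fun i => gaussianReal (m i) (v i)) ^ 2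
      ≤ (∑ o, m (e o) ^ 2)
        * ∑ o, ∫ θ, H o θ ^ 2 ∂Measure.pi (fun i => gaussianReal (m i) (v i)) := by
  set Q := Measure.pi fun i => gaussianReal (m i) (v i) with hQ
  have hψ0 : ψ 0 = 0 := by have := hodd 0; rw [neg_zero] at this; linarith
  have hz : MemLp (linForm e H) 2 Q := memLp_linForm hmeas hH hdep
  have ha : MemLp (fun θ => ∑ o, m (e o) * H o θ) 2 Q :=
    memLp_finsetSum _ fun o _ => (hH o).const_mul (m (e o))
  -- The reflection moves only the weights and leaves every `H o` unchanged.
  have hR := measurePreserving_reflect (m := m) (v := v) (Set.range e)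
  have hrefl : ∀ θ, linForm e H (reflect m (Set.range e) θ)
      = 2 * (∑ o, m (e o) * H o θ) - linForm e H θ := fun θ => by
    simp only [linForm]
    rw [Finset.mul_sum, ← Finset.sum_sub_distrib]
    refine Finset.sum_congr rfl fun o _ => ?_
    have h : H o (reflect m (Set.range e) θ) = H o θ :=
      hdep o fun i hi => if_neg hi
    rw [h, reflect, if_pos (Set.mem_range_self o)]
    ring
  have hψz : MemLp (fun θ => ψ (linForm e H θ)) 2 Q := hψ.comp_memLp hψ0 hz
  have hψz' : MemLp (fun θ => ψ (2 * (∑ o, m (e o) * H o θ) - linForm e H θ)) 2 Q :=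
    hψ.comp_memLp hψ0 ((ha.const_mul 2).sub hz)
  have heq : ∫ θ, ψ (2 * (∑ o, m (e o) * H o θ) - linForm e H θ) ∂Q
      = ∫ θ, ψ (linForm e H θ) ∂Q := by
    simp_rw [← hrefl]
    have h := integral_map (μ := Q) hR.measurable.aemeasurable
      (f := fun θ => ψ (linForm e H θ)) (by rw [hR.map_eq]; exact hψz.aestronglyMeasurable)
    rw [hR.map_eq] at h
    exact h.symm
  have hsymm : ∫ θ, ψ (linForm e H θ) ∂Q
      = ∫ θ, (ψ (linForm e H θ) + ψ (2 * (∑ o, m (e o) * H o θ) - linForm e H θ)) / 2 ∂Q := by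
    rw [integral_div, integral_add (hψz.integrable one_le_two) (hψz'.integrable one_le_two), heq]
    ring
  have hL : MemLp (fun θ => (ψ (linForm e H θ)
      + ψ (2 * (∑ o, m (e o) * H o θ) - linForm e H θ)) / 2) 2 Q := by
    simp_rw [div_eq_inv_mul]
    exact (hψz.add hψz').const_mul _
  rw [hsymm]
  refine (sq_integral_le_integral_sq hL).trans
    (le_trans (integral_mono hL.integrable_sq ha.integrable_sq fun θ => ?_)
      (integral_sum_mul_sq_le _ hH))
  -- By oddness the sum of the two values of `ψ` is a difference of values at points `2|a|` apart,
  -- where `a = ∑ m H`.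
  have h := hψ.dist_le_mul (linForm e H θ) (-(2 * (∑ o, m (e o) * H o θ) - linForm e H θ))
  rw [hodd, Real.dist_eq, Real.dist_eq, NNReal.coe_one, one_mul] at h
  refine sq_le_sq.2 ?_
  rw [neg_sub, sub_neg_eq_add, sub_sub_cancel, abs_mul, abs_two] at h
  rw [abs_div, abs_two, div_le_iff₀ two_pos]
  linarith

end Moments

/-! ### The layers of the network as linear forms, and their dependence on the parameters. -/

section Layers

variable {Di M Do L : ℕ}

/-- The parameters feeding the first hidden layer; `none` stands for the bias. -/
def inputIdx : Fin M × Option (Fin Di) → ParamIdx Di M Do L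
  | (i, none) => .inputBias i
  | (i, some j) => .inputWeight i j

/-- The parameters feeding hidden layer number `ℓ + 2`; `none` stands for the bias. -/
def hiddenIdx (ℓ : Fin (L - 1)) : Fin M × Option (Fin M) → ParamIdx Di M Do L
  | (i, none) => .hiddenBias ℓ i
  | (i, some j) => .hiddenWeight ℓ i j

/-- The weights of the output layer. -/
def outputIdx (p : Fin Do × Fin M) : ParamIdx Di M Do L := .outputWeight p.1 p.2

lemma inputIdx_injective : Function.Injective (inputIdx : _ → ParamIdx Di M Do L) := by
  rintro ⟨i, _ | j⟩ ⟨i', _ | j'⟩ h <;> simp_all [inputIdx]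

lemma hiddenIdx_injective (ℓ : Fin (L - 1)) :
    Function.Injective (hiddenIdx ℓ : _ → ParamIdx Di M Do L) := by
  rintro ⟨i, _ | j⟩ ⟨i', _ | j'⟩ h <;> simp_all [hiddenIdx]

lemma outputIdx_injective : Function.Injective (outputIdx : _ → ParamIdx Di M Do L) := by
  rintro ⟨i, j⟩ ⟨i', j'⟩ h
  simp_all [outputIdx]

/-- The number of layers below the one that a parameter belongs to. -/
def level : ParamIdx Di M Do L → ℕ
  | .inputWeight _ _ => 0
  | .inputBias _ => 0
  | .hiddenWeight ℓ _ _ => ℓ + 1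
  | .hiddenBias ℓ _ => ℓ + 1
  -- Not `L`: the output layer must lie strictly above `L - 1` even when `L = 0`.
  | .outputWeight _ _ => L - 1 + 1
  | .outputBias _ => L - 1 + 1

lemma level_inputIdx (p) : level (inputIdx p : ParamIdx Di M Do L) = 0 := by
  rcases p with ⟨i, _ | j⟩ <;> rfl

lemma level_hiddenIdx (ℓ : Fin (L - 1)) (p) :
    level (hiddenIdx ℓ p : ParamIdx Di M Do L) = ℓ + 1 := by
  rcases p with ⟨i, _ | j⟩ <;> rfl

/-- The scaled input of the first hidden layer, extended by the constant that multiplies the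
bias. -/
noncomputable def inputAct (x : EuclideanSpace ℝ (Fin Di)) :
    Option (Fin Di) → Params Di M Do L → ℝ
  | none, _ => 1
  | some j, _ => x j / √(Di : ℝ)

/-- The scaled output of a hidden layer, extended by the constant that multiplies the bias of the
next layer. -/
noncomputable def hiddenAct (φ : ℝ → ℝ) (x : EuclideanSpace ℝ (Fin Di)) (ℓ : ℕ) (h : ℓ ≤ L - 1) :
    Option (Fin M) → Params Di M Do L → ℝ
  | none, _ => 1
  | some j, θ => φ (preact φ θ x ℓ h j) / √(M : ℝ)

/-- Treating the bias as a weight on the constant input `1` lets one estimate serve all hidden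
layers. -/
lemma preact_zero_eq_linForm (φ : ℝ → ℝ) (x : EuclideanSpace ℝ (Fin Di)) (h : 0 ≤ L - 1)
    (i : Fin M) (θ : Params Di M Do L) :
    preact φ θ x 0 h i = linForm (fun o => inputIdx (i, o)) (inputAct x) θ := by
  simp only [preact, linForm, Fintype.sum_option, inputIdx, inputAct, Pi.add_apply, Pi.smul_apply,
    Matrix.mulVec, dotProduct, Params.inputWeight, Params.inputBias, Matrix.of_apply, smul_eq_mul,
    Finset.mul_sum, mul_one]
  rw [add_comm]
  congr 1
  exact Finset.sum_congr rfl fun j _ => by ring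

lemma preact_succ_eq_linForm (φ : ℝ → ℝ) (x : EuclideanSpace ℝ (Fin Di)) (ℓ : ℕ)
    (h : ℓ + 1 ≤ L - 1) (i : Fin M) (θ : Params Di M Do L) :
    preact φ θ x (ℓ + 1) h i
      = linForm (fun o => hiddenIdx ⟨ℓ, h⟩ (i, o)) (hiddenAct φ x ℓ (Nat.le_of_succ_le h)) θ := by
  simp only [preact, linForm, Fintype.sum_option, hiddenIdx, hiddenAct, Pi.add_apply,
    Pi.smul_apply, Matrix.mulVec, dotProduct, Params.hiddenWeight, Params.hiddenBias,
    Matrix.of_apply, smul_eq_mul, Finset.mul_sum, mul_one]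
  rw [add_comm]
  congr 1
  exact Finset.sum_congr rfl fun j _ => by ring

/-- This is the source of the independence between the weights of a layer and its input. -/
lemma dependsOn_preact (φ : ℝ → ℝ) (x : EuclideanSpace ℝ (Fin Di)) (ℓ : ℕ) (h : ℓ ≤ L - 1) :
    DependsOn (fun θ : Params Di M Do L => preact φ θ x ℓ h) {k | level k ≤ ℓ} := by
  induction ℓ with
  | zero =>
    intro θ θ' hθ
    funext i
    simp only [preact_zero_eq_linForm, linForm]
    refine Finset.sum_congr rfl fun o _ => ?_
    rw [hθ _ (level_inputIdx _).le]
    cases o <;> rfl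
  | succ ℓ ih =>
    intro θ θ' hθ
    have hz : preact φ θ x ℓ (Nat.le_of_succ_le h) = preact φ θ' x ℓ (Nat.le_of_succ_le h) :=
      ih _ fun k hk => hθ k (Nat.le_succ_of_le hk)
    funext i
    simp only [preact_succ_eq_linForm, linForm]
    refine Finset.sum_congr rfl fun o _ => ?_
    rw [hθ _ (level_hiddenIdx _ _).le]
    cases o with
    | none => rfl
    | some j => simp only [hiddenAct, hz]

lemma dependsOn_preact_apply (φ : ℝ → ℝ) (x : EuclideanSpace ℝ (Fin Di)) (ℓ : ℕ) (h : ℓ ≤ L - 1)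
    {κ : Type*} {e : κ → ParamIdx Di M Do L} (he : ∀ o, ℓ < level (e o)) (g : ℝ → ℝ) (j : Fin M) :
    DependsOn (fun θ : Params Di M Do L => g (preact φ θ x ℓ h j)) (Set.range e)ᶜ := by
  intro θ θ' hθ
  have hz := dependsOn_preact φ x ℓ h fun k hk => hθ k ?_
  · exact congrArg g (congrFun hz j)
  · rintro ⟨o, rfl⟩
    exact absurd hk (not_le.2 (he o))

lemma measurable_preact {φ : ℝ → ℝ} (hφ : Measurable φ) (x : EuclideanSpace ℝ (Fin Di)) (ℓ : ℕ)
    (h : ℓ ≤ L - 1) (i : Fin M) :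
    Measurable fun θ : Params Di M Do L => preact φ θ x ℓ h i := by
  induction ℓ generalizing i with
  | zero =>
    simp only [preact_zero_eq_linForm, linForm]
    refine Finset.measurable_sum _ fun o _ => (measurable_pi_apply _).mul ?_
    cases o <;> exact measurable_const
  | succ ℓ ih =>
    simp only [preact_succ_eq_linForm, linForm]
    refine Finset.measurable_sum _ fun o _ => (measurable_pi_apply _).mul ?_
    cases o with
    | none => exact measurable_const
    | some j => exact (hφ.comp (ih _ j)).div_const _

lemma measurable_hiddenAct {φ : ℝ → ℝ} (hφ : Measurable φ) (x : EuclideanSpace ℝ (Fin Di)) (ℓ : ℕ)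
    (h : ℓ ≤ L - 1) (o : Option (Fin M)) :
    Measurable (hiddenAct φ x ℓ h o : Params Di M Do L → ℝ) := by
  cases o with
  | none => exact measurable_const
  | some j => exact (hφ.comp (measurable_preact hφ x ℓ h j)).div_const _

lemma dependsOn_hiddenAct (φ : ℝ → ℝ) (x : EuclideanSpace ℝ (Fin Di)) (ℓ : ℕ) (h : ℓ ≤ L - 1)
    {κ : Type*} {e : κ → ParamIdx Di M Do L} (he : ∀ o, ℓ < level (e o)) (o : Option (Fin M)) :
    DependsOn (hiddenAct φ x ℓ h o : Params Di M Do L → ℝ) (Set.range e)ᶜ := by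
  cases o with
  | none => exact fun _ _ _ => rfl
  | some j => exact dependsOn_preact_apply φ x ℓ h he (fun a => φ a / √(M : ℝ)) j

end Layers

/-! ### Growth and symmetry of the activation. -/

section Activation

variable {φ : ℝ → ℝ} {α : ℝ}

lemma lipschitzWith_sub_const (hφ : LipschitzWith 1 φ) (α : ℝ) :
    LipschitzWith 1 fun a => φ a - α := by
  refine LipschitzWith.of_dist_le_mul fun a b => ?_
  rw [dist_sub_right]
  exact hφ.dist_le_mul a b

lemma sub_const_odd (hα : ∀ a, evenPart φ a = α) (a : ℝ) : φ (-a) - α = -(φ a - α) := by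
  have := hα a
  rw [evenPart] at this
  linarith

lemma abs_apply_le (hφ : LipschitzWith 1 φ) (hα : ∀ a, evenPart φ a = α) (a : ℝ) :
    |φ a| ≤ |α| + |a| := by
  have h0 : φ 0 = α := by
    have := hα 0
    rw [evenPart, neg_zero] at this
    linarith
  have h := hφ.dist_le_mul a 0
  rw [Real.dist_eq, Real.dist_eq, h0, NNReal.coe_one, one_mul, sub_zero] at h
  calc |φ a| = |α + (φ a - α)| := by ring_nf
    _ ≤ |α| + |φ a - α| := abs_add_le _ _
    _ ≤ |α| + |a| := by gcongr

/-- The cross term `2|α||a|` is split by AM-GM with weight `B`. If `a²` has mean at most `B²`,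
averaging gives exactly `(|α| + B)²`. -/
lemma sq_apply_le (hφ : LipschitzWith 1 φ) (hα : ∀ a, evenPart φ a = α) {B : ℝ} (hB : 0 < B)
    (a : ℝ) : φ a ^ 2 ≤ |α| ^ 2 + |α| * B + (|α| / B + 1) * a ^ 2 := by
  have h := abs_apply_le hφ hα a
  have h₁ : φ a ^ 2 ≤ (|α| + |a|) ^ 2 := by
    rw [← sq_abs]
    exact pow_le_pow_left₀ (abs_nonneg _) h 2
  have h₂ : 2 * |a| ≤ B + a ^ 2 / B := by
    rw [← sq_abs, ← sub_nonneg]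
    have : B + |a| ^ 2 / B - 2 * |a| = (B - |a|) ^ 2 / B := by field_simp; ring
    rw [this]
    positivity
  have h₃ := mul_le_mul_of_nonneg_left h₂ (abs_nonneg α)
  have h₄ : |α| * (B + a ^ 2 / B) = |α| * B + |α| / B * a ^ 2 := by ring
  nlinarith [sq_abs a]

end Activation

/-! ### Bounds carried through the layers to the output. -/

section Propagation

variable {Di M Do L : ℕ} {m : ParamIdx Di M Do L → ℝ} {v : ParamIdx Di M Do L → ℝ≥0}
  {φ : ℝ → ℝ} {α K : ℝ}

/-- Bound on the root mean square of the input of hidden layer number `ℓ + 1`. -/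
noncomputable def actBound (S K : ℝ) (ℓ : ℕ) : ℝ := (ℓ + 1) * (1 + K) ^ ℓ * S

lemma actBound_nonneg {S : ℝ} (hS : 0 ≤ S) (hK : 0 ≤ K) (ℓ : ℕ) : 0 ≤ actBound S K ℓ := by
  unfold actBound; positivity

/-- Each layer multiplies by `1 + K` and adds a fresh `S`; bounding every summand by the largest
power produces the linear factor in the depth. -/
lemma actBound_step {S : ℝ} (hS : 0 ≤ S) (hK : 0 ≤ K) (ℓ : ℕ) :
    S + (1 + K) * actBound S K ℓ ≤ actBound S K (ℓ + 1) := by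
  have h : (1 : ℝ) ≤ (1 + K) ^ (ℓ + 1) := one_le_pow₀ (by linarith)
  have h' := mul_le_mul_of_nonneg_right h hS
  unfold actBound
  push_cast
  calc S + (1 + K) * ((ℓ + 1) * (1 + K) ^ ℓ * S)
      = 1 * S + (ℓ + 1) * ((1 + K) ^ (ℓ + 1) * S) := by ring
    _ ≤ (1 + K) ^ (ℓ + 1) * S + (ℓ + 1) * ((1 + K) ^ (ℓ + 1) * S) := by gcongr
    _ = _ := by ring

/-- One layer of the network: the second moments of the preactivations, and the expectation of
an odd function of them. -/
lemma layer_bounds {κ : Type*} [Fintype κ] (hM : 0 < M) (hK : 0 ≤ K)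
    (hmv : ∑ i, (m i ^ 2 + (√(v i : ℝ) - 1) ^ 2) ≤ K ^ 2)
    {e : Fin M × κ → ParamIdx Di M Do L} (he : Function.Injective e)
    {H : κ → Params Di M Do L → ℝ} (hmeas : ∀ o, Measurable (H o))
    (hH : ∀ o, MemLp (H o) 2 (diagGaussian m v))
    (hdep : ∀ o, DependsOn (H o) (Set.range e)ᶜ) {ψ : ℝ → ℝ} (hψ : LipschitzWith 1 ψ)
    (hodd : ∀ a, ψ (-a) = -ψ a) {G : ℝ} (hG : ∑ o, ∫ θ, H o θ ^ 2 ∂diagGaussian m v ≤ G ^ 2) :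
    (∀ i, MemLp (linForm (fun o => e (i, o)) H) 2 (diagGaussian m v)) ∧
      ∑ i, ∫ θ, linForm (fun o => e (i, o)) H θ ^ 2 ∂diagGaussian m v
        ≤ M * ((1 + K) * G) ^ 2 ∧
      ∑ i, (∫ θ, ψ (linForm (fun o => e (i, o)) H θ) ∂diagGaussian m v) ^ 2 ≤ (K * G) ^ 2 := by
  have hdep' : ∀ i o, DependsOn (H o) (Set.range fun o => e (i, o))ᶜ := fun i o =>
    (hdep o).mono (Set.compl_subset_compl.2 (by rintro _ ⟨p, rfl⟩; exact ⟨_, rfl⟩))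
  have hE : 0 ≤ ∑ o, ∫ θ, H o θ ^ 2 ∂diagGaussian m v :=
    Finset.sum_nonneg fun o _ => integral_nonneg fun _ => sq_nonneg _
  refine ⟨fun i => memLp_linForm hmeas hH (hdep' i), ?_, ?_⟩
  · refine (sum_integral_linForm_sq_le he hmeas hH hdep hK hmv).trans ?_
    rw [Fintype.card_fin, mul_pow, ← mul_assoc]
    -- As `√M ≥ 1`, `√M + K ≤ √M (1 + K)`; the factor `M` this leaves cancels against the `1/√M`
    -- scaling of the next layer.
    have hM1 : (1 : ℝ) ≤ √(M : ℝ) := Real.one_le_sqrt.2 (by exact_mod_cast hM)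
    have : (√(M : ℝ) + K) ^ 2 ≤ M * (1 + K) ^ 2 := by
      nth_rewrite 2 [← Real.sq_sqrt (Nat.cast_nonneg M)]
      rw [← mul_pow]
      exact pow_le_pow_left₀ (by positivity) (by nlinarith) 2
    exact mul_le_mul this hG hE (by positivity)
  · refine (Finset.sum_le_sum fun i _ =>
      sq_integral_comp_linForm_le hmeas hH (hdep' i) hψ hodd).trans ?_
    rw [← Finset.sum_mul, mul_pow]
    refine mul_le_mul ?_ hG hE (sq_nonneg _)
    refine le_trans ?_ ((sum_comp_le_sum he fun i => by positivity).trans hmv)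
    rw [Fintype.sum_prod_type]
    gcongr
    exact le_add_of_nonneg_right (sq_nonneg _)

instance : IsProbabilityMeasure (diagGaussian m v) := by
  unfold diagGaussian; infer_instance

lemma memLp_comp_of_lipschitz {Ω : Type*} [MeasurableSpace Ω] {P : Measure Ω}
    [IsFiniteMeasure P] (hφ : LipschitzWith 1 φ) {f : Ω → ℝ} (hf : MemLp f 2 P) :
    MemLp (fun ω => φ (f ω)) 2 P := by
  have h := (lipschitzWith_sub_const hφ (φ 0)).comp_memLp (by simp) hf
  refine (h.add (memLp_const (φ 0))).ae_eq (.of_forall fun ω => ?_)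
  simp

lemma sum_integral_hiddenAct_sq_le (hM : 0 < M) (hφ : LipschitzWith 1 φ)
    (hα : ∀ a, evenPart φ a = α) (x : EuclideanSpace ℝ (Fin Di)) (ℓ : ℕ) (h : ℓ ≤ L - 1) {B : ℝ}
    (hB : 0 < B)
    (hmem : ∀ i, MemLp (fun θ : Params Di M Do L => preact φ θ x ℓ h i) 2 (diagGaussian m v))
    (hsum : ∑ i, ∫ θ, preact φ θ x ℓ h i ^ 2 ∂diagGaussian m v ≤ M * B ^ 2) :
    ∑ o, ∫ θ, hiddenAct φ x ℓ h o θ ^ 2 ∂diagGaussian m v ≤ (1 + |α| + B) ^ 2 := by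
  have hM' : (0 : ℝ) < M := by exact_mod_cast hM
  have hint : ∀ i, ∫ θ, φ (preact φ θ x ℓ h i) ^ 2 ∂diagGaussian m v
      ≤ |α| ^ 2 + |α| * B + (|α| / B + 1) * ∫ θ, preact φ θ x ℓ h i ^ 2 ∂diagGaussian m v := by
    intro i
    refine (integral_mono (memLp_comp_of_lipschitz hφ (hmem i)).integrable_sq
      ((integrable_const _).add ((hmem i).integrable_sq.const_mul _))
      fun θ => sq_apply_le hφ hα hB _).trans_eq ?_
    rw [integral_add' (integrable_const _) ((hmem i).integrable_sq.const_mul _),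
      integral_const_mul, integral_const, probReal_univ, one_smul]
  have htot : ∑ i, ∫ θ, φ (preact φ θ x ℓ h i) ^ 2 ∂diagGaussian m v
      ≤ M * (|α| + B) ^ 2 := by
    refine (Finset.sum_le_sum fun i _ => hint i).trans ?_
    rw [Finset.sum_add_distrib, ← Finset.mul_sum, Finset.sum_const, Finset.card_univ,
      Fintype.card_fin, nsmul_eq_mul]
    have := mul_le_mul_of_nonneg_left hsum (by positivity : 0 ≤ |α| / B + 1)
    have h' : (|α| / B + 1) * (M * B ^ 2) = M * (|α| * B + B ^ 2) := by field_simp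
    nlinarith
  rw [Fintype.sum_option]
  simp only [hiddenAct, div_pow, Real.sq_sqrt hM'.le, integral_div]
  rw [← Finset.sum_div, one_pow, integral_const, probReal_univ, one_smul]
  have : (∑ i, ∫ θ, φ (preact φ θ x ℓ h i) ^ 2 ∂diagGaussian m v) / M ≤ (|α| + B) ^ 2 := by
    rw [div_le_iff₀ hM']
    linarith
  nlinarith [abs_nonneg α]

/-- The induction uses only the first two conclusions; the bound on odd expectations at a layer is
not needed for the layers above. -/
lemma preact_bounds (hM : 0 < M) (hK : 0 ≤ K)
    (hmv : ∑ i, (m i ^ 2 + (√(v i : ℝ) - 1) ^ 2) ≤ K ^ 2) (hφ : LipschitzWith 1 φ)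
    (hα : ∀ a, evenPart φ a = α) (x : EuclideanSpace ℝ (Fin Di)) (ℓ : ℕ) (h : ℓ ≤ L - 1) :
    (∀ i, MemLp (fun θ : Params Di M Do L => preact φ θ x ℓ h i) 2 (diagGaussian m v)) ∧
      ∑ i, ∫ θ, preact φ θ x ℓ h i ^ 2 ∂diagGaussian m v
        ≤ M * ((1 + K) * actBound (|α| + 1 + ‖x‖ / √(Di : ℝ)) K ℓ) ^ 2 ∧
      ∑ i, (∫ θ, (φ (preact φ θ x ℓ h i) - α) ∂diagGaussian m v) ^ 2
        ≤ (K * actBound (|α| + 1 + ‖x‖ / √(Di : ℝ)) K ℓ) ^ 2 := by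
  have hψ := lipschitzWith_sub_const hφ α
  have hodd := sub_const_odd hα
  have hφm : Measurable φ := hφ.continuous.measurable
  set S := |α| + 1 + ‖x‖ / √(Di : ℝ) with hS
  have hx : 0 ≤ ‖x‖ / √(Di : ℝ) := by positivity
  have hS1 : 0 < S := by positivity
  induction ℓ with
  | zero =>
    simp only [preact_zero_eq_linForm]
    refine layer_bounds hM hK hmv inputIdx_injective ?_ ?_ ?_ hψ hodd ?_
    · rintro (_ | j) <;> exact measurable_const
    · rintro (_ | j) <;> exact memLp_const _
    · rintro (_ | j) <;> exact fun _ _ _ => rfl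
    · rw [Fintype.sum_option]
      simp only [inputAct, integral_const, probReal_univ, one_smul, one_pow, div_pow]
      rw [← Finset.sum_div, Real.sq_sqrt (Nat.cast_nonneg _)]
      have hn : (∑ j, x j ^ 2) / (Di : ℝ) = (‖x‖ / √(Di : ℝ)) ^ 2 := by
        rw [div_pow, Real.sq_sqrt (Nat.cast_nonneg _), EuclideanSpace.real_norm_sq_eq]
      rw [hn, actBound]
      simp only [CharP.cast_eq_zero, zero_add, pow_zero, one_mul]
      rw [hS]
      nlinarith [abs_nonneg α]
  | succ ℓ ih =>
    obtain ⟨hmem, hsum, -⟩ := ih (Nat.le_of_succ_le h)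
    simp only [preact_succ_eq_linForm]
    refine layer_bounds hM hK hmv (hiddenIdx_injective _) (measurable_hiddenAct hφm x ℓ _) ?_
      (dependsOn_hiddenAct φ x ℓ _ fun o => by rw [level_hiddenIdx]; exact Nat.lt_succ_self ℓ)
      hψ hodd ?_
    · rintro (_ | j)
      · exact memLp_const _
      · refine ((memLp_comp_of_lipschitz hφ (hmem j)).const_mul (√(M : ℝ))⁻¹).ae_eq
          (.of_forall fun θ => ?_)
        exact (div_eq_inv_mul _ _).symm
    · have hpos : 0 < (1 + K) * actBound S K ℓ := by unfold actBound; positivity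
      refine (sum_integral_hiddenAct_sq_le hM hφ hα x ℓ _ hpos hmem hsum).trans ?_
      refine pow_le_pow_left₀ (by positivity) (le_trans ?_ (actBound_step hS1.le hK ℓ)) 2
      linarith

lemma networkTilde_apply (x : EuclideanSpace ℝ (Fin Di)) (θ : Params Di M Do L) (i : Fin Do) :
    networkTilde φ α θ x i
      = ∑ j, (1 / √(M : ℝ))
        * (θ (outputIdx (i, j)) * (φ (preact φ θ x (L - 1) le_rfl j) - α)) := by
  simp only [networkTilde, network, PiLp.sub_apply, Pi.add_apply, Pi.smul_apply, Matrix.mulVec,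
    dotProduct, Params.outputWeight, Matrix.of_apply, smul_eq_mul, outputIdx, Finset.mul_sum]
  rw [add_sub_right_comm, add_sub_cancel_right, ← Finset.sum_sub_distrib]
  exact Finset.sum_congr rfl fun j _ => by ring

/-- The output weights are independent of the last hidden layer, so each expectation is `m · E[φ(z)
- α]`. Cauchy–Schwarz gives one factor `K` from the means and another from the odd expectations. -/
lemma integrable_networkTilde_and_norm_integral_le (hM : 0 < M) (hK : 0 ≤ K)
    (hmv : ∑ i, (m i ^ 2 + (√(v i : ℝ) - 1) ^ 2) ≤ K ^ 2) (hφ : LipschitzWith 1 φ)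
    (hα : ∀ a, evenPart φ a = α) (x : EuclideanSpace ℝ (Fin Di)) :
    Integrable (fun θ : Params Di M Do L => networkTilde φ α θ x) (diagGaussian m v) ∧
      ‖∫ θ, networkTilde φ α θ x ∂diagGaussian m v‖
        ≤ K ^ 2 * actBound (|α| + 1 + ‖x‖ / √(Di : ℝ)) K (L - 1) / √(M : ℝ) := by
  obtain ⟨hmem, -, hodd⟩ := preact_bounds hM hK hmv hφ hα x (L - 1) le_rfl
  have hA := actBound_nonneg (by positivity : 0 ≤ |α| + 1 + ‖x‖ / √(Di : ℝ)) hK (L - 1)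
  set A := actBound (|α| + 1 + ‖x‖ / √(Di : ℝ)) K (L - 1)
  have hφm : Measurable φ := hφ.continuous.measurable
  have hψmem : ∀ j, MemLp (fun θ : Params Di M Do L => φ (preact φ θ x (L - 1) le_rfl j) - α) 2
      (diagGaussian m v) := fun j => memLp_comp_of_lipschitz (lipschitzWith_sub_const hφ α) (hmem j)
  have hψmeas : ∀ j, Measurable
      (fun θ : Params Di M Do L => φ (preact φ θ x (L - 1) le_rfl j) - α) :=
    fun j => (hφm.comp (measurable_preact hφm x _ _ j)).sub_const α
  have hterm : ∀ i j, Integrable (fun θ : Params Di M Do L => (1 / √(M : ℝ))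
      * (θ (outputIdx (i, j)) * (φ (preact φ θ x (L - 1) le_rfl j) - α))) (diagGaussian m v) :=
    fun i j => ((memLp_eval (outputIdx (i, j))).integrable_mul (hψmem j)).const_mul _
  have hcoord : ∀ i, Integrable (fun θ : Params Di M Do L => networkTilde φ α θ x i)
      (diagGaussian m v) := fun i => by
    simp only [networkTilde_apply]
    exact integrable_finsetSum _ fun j _ => hterm i j
  refine ⟨Integrable.of_eval_piLp hcoord, ?_⟩
  have hval : ∀ i, (∫ θ, networkTilde φ α θ x ∂diagGaussian m v) i
      = (1 / √(M : ℝ)) * ∑ j, m (outputIdx (i, j))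
        * ∫ θ, (φ (preact φ θ x (L - 1) le_rfl j) - α) ∂diagGaussian m v := fun i => by
    rw [eval_integral_piLp hcoord]
    simp only [networkTilde_apply]
    rw [integral_finsetSum _ fun j _ => hterm i j, Finset.mul_sum]
    refine Finset.sum_congr rfl fun j _ => ?_
    rw [integral_const_mul]
    congr 1
    exact integral_eval_mul (e := outputIdx) (hψmeas j)
      (dependsOn_preact_apply φ x _ _ (fun _ => Nat.lt_succ_self _) (fun a => φ a - α) j) (i, j)
  have hmean : ∑ i, ∑ j, m (outputIdx (i, j)) ^ 2 ≤ K ^ 2 := by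
    refine le_trans ?_ ((sum_comp_le_sum outputIdx_injective fun i => by positivity).trans hmv)
    rw [Fintype.sum_prod_type]
    gcongr
    exact le_add_of_nonneg_right (sq_nonneg _)
  refine le_of_sq_le_sq ?_ (by positivity)
  rw [EuclideanSpace.real_norm_sq_eq]
  calc ∑ i, ((∫ θ, networkTilde φ α θ x ∂diagGaussian m v) i) ^ 2
      ≤ ∑ i, (1 / √(M : ℝ)) ^ 2 * ((∑ j, m (outputIdx (i, j)) ^ 2) * (K * A) ^ 2) := by
        refine Finset.sum_le_sum fun i _ => ?_
        rw [hval, mul_pow]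
        refine mul_le_mul_of_nonneg_left ?_ (by positivity)
        exact (Finset.sum_mul_sq_le_sq_mul_sq _ _ _).trans
          (mul_le_mul_of_nonneg_left hodd (by positivity))
    _ = (1 / √(M : ℝ)) ^ 2 * ((∑ i, ∑ j, m (outputIdx (i, j)) ^ 2) * (K * A) ^ 2) := by
        rw [← Finset.mul_sum, ← Finset.sum_mul]
    _ ≤ (1 / √(M : ℝ)) ^ 2 * (K ^ 2 * (K * A) ^ 2) := by gcongr
    _ = (K ^ 2 * A / √(M : ℝ)) ^ 2 := by ring

lemma integrable_finalAffine :
    Integrable (fun θ : Params Di M Do L =>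
      (WithLp.toLp 2 ((α / √(M : ℝ)) • θ.outputWeight.mulVec (fun _ => (1 : ℝ)))
        : EuclideanSpace ℝ (Fin Do)) + WithLp.toLp 2 θ.outputBias) (diagGaussian m v) := by
  have h : ∀ k, Integrable (fun θ : Params Di M Do L => θ k) (diagGaussian m v) :=
    fun k => (memLp_eval k).integrable one_le_two
  refine Integrable.add (Integrable.of_eval_piLp fun i => ?_)
    (Integrable.of_eval_piLp fun i => h (.outputBias i))
  simp only [Pi.smul_apply, Matrix.mulVec, dotProduct, Params.outputWeight, Matrix.of_apply,
    smul_eq_mul, mul_one]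
  exact (integrable_finsetSum _ fun j _ => h (.outputWeight i j)).const_mul _

/-- Since `1 + √t ≤ 2 max(√t, 1)`; this is where the base `c₂ = 2` comes from. -/
lemma one_add_sqrt_pow_le {t : ℝ} (ht : 0 ≤ t) (n : ℕ) :
    (1 + √t) ^ n ≤ 2 ^ n * max (t ^ ((n : ℝ) / 2)) 1 := by
  have hpow : t ^ ((n : ℝ) / 2) = √t ^ n := by
    rw [Real.sqrt_eq_rpow, ← Real.rpow_natCast, ← Real.rpow_mul ht]
    congr 1
    ring
  rw [hpow]
  rcases le_total (√t) 1 with h | h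
  · calc (1 + √t) ^ n ≤ 2 ^ n := pow_le_pow_left₀ (by positivity) (by linarith) n
      _ ≤ _ := le_mul_of_one_le_right (by positivity) (le_max_right _ _)
  · calc (1 + √t) ^ n ≤ (2 * √t) ^ n := pow_le_pow_left₀ (by positivity) (by linarith) n
      _ = 2 ^ n * √t ^ n := mul_pow _ _ _
      _ ≤ _ := by gcongr; exact le_max_left _ _

lemma networkTilde_bound (hM : 0 < M) (hL : 1 ≤ L) (hv : ∀ i, 0 < v i)
    (hφ : LipschitzWith 1 φ) (hα : ∀ a, evenPart φ a = α) (x : EuclideanSpace ℝ (Fin Di)) :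
    Integrable (fun θ : Params Di M Do L => networkTilde φ α θ x) (diagGaussian m v) ∧
      ‖∫ θ, networkTilde φ α θ x ∂diagGaussian m v‖
        ≤ 2 * 2 ^ (L - 1) * (L : ℝ) * ((|α| + 1 + ‖x‖ / √(Di : ℝ)) / √(M : ℝ))
          * klPrior (diagGaussian m v)
          * max ((2 * klPrior (diagGaussian m v)) ^ (((L : ℝ) - 1) / 2)) 1 := by
  have hkl : 0 ≤ klPrior (diagGaussian m v) := ENNReal.toReal_nonneg
  have hmv : ∑ i, (m i ^ 2 + (√(v i : ℝ) - 1) ^ 2) ≤ √(2 * klPrior (diagGaussian m v)) ^ 2 := by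
    rw [Real.sq_sqrt (by positivity)]
    exact sum_sq_add_sum_sq_le_klDiv m hv
  obtain ⟨hint, hle⟩ := integrable_networkTilde_and_norm_integral_le hM (Real.sqrt_nonneg _)
    hmv hφ hα x
  refine ⟨hint, hle.trans ?_⟩
  generalize klPrior (diagGaussian m v) = t at hkl
  -- Truncated subtraction agrees with the real exponent because `1 ≤ L`.
  have hcast : ((L - 1 : ℕ) : ℝ) = (L : ℝ) - 1 := by push_cast [hL]; ring
  have hp := one_add_sqrt_pow_le (by positivity : 0 ≤ 2 * t) (L - 1)
  rw [hcast] at hp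
  rw [actBound, hcast, Real.sq_sqrt (by positivity), sub_add_cancel]
  have hS : 0 ≤ |α| + 1 + ‖x‖ / √(Di : ℝ) := by positivity
  calc 2 * t * (L * (1 + √(2 * t)) ^ (L - 1) * (|α| + 1 + ‖x‖ / √(Di : ℝ))) / √(M : ℝ)
      ≤ 2 * t * (L * (2 ^ (L - 1) * max ((2 * t) ^ (((L : ℝ) - 1) / 2)) 1)
          * (|α| + 1 + ‖x‖ / √(Di : ℝ))) / √(M : ℝ) := by gcongr
    _ = _ := by ring

lemma network_eq_networkTilde_add (x : EuclideanSpace ℝ (Fin Di)) (θ : Params Di M Do L) :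
    network φ θ x = networkTilde φ α θ x
      + (WithLp.toLp 2 ((α / √(M : ℝ)) • θ.outputWeight.mulVec (fun _ => (1 : ℝ)))
        + WithLp.toLp 2 θ.outputBias) := by
  rw [networkTilde]
  abel

end Propagation

end MeanFieldBNN

/-! ### The main theorem. -/

theorem mainTheorem2 :
    ∃ c₁ c₂ : ℝ, 0 < c₁ ∧ c₁ ≤ 4 ∧ 0 < c₂ ∧ c₂ ≤ 6 ∧
      ∀ (Di M Do L : ℕ), 0 < Di → 0 < M → 1 ≤ L →
      ∀ (φ : ℝ → ℝ) (α : ℝ), LipschitzWith 1 φ → (∀ a, MeanFieldBNN.evenPart φ a = α) →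
      ∀ Q : MeasureTheory.Measure (MeanFieldBNN.Params Di M Do L),
        MeanFieldBNN.IsMeanFieldGaussian Q →
        InformationTheory.klDiv Q (MeanFieldBNN.prior Di M Do L) ≠ ⊤ ∧
        (∀ x : EuclideanSpace ℝ (Fin Di),
          MeasureTheory.Integrable (fun θ => MeanFieldBNN.networkTilde φ α θ x) Q ∧
          ‖∫ θ, MeanFieldBNN.networkTilde φ α θ x ∂Q‖
            ≤ c₁ * c₂ ^ (L - 1) * (L : ℝ)
              * ((|α| + 1 + ‖x‖ / √(Di : ℝ)) / √(M : ℝ))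
              * MeanFieldBNN.klPrior Q
              * max ((2 * MeanFieldBNN.klPrior Q) ^ (((L : ℝ) - 1) / 2)) 1) ∧
        (∀ x x' : EuclideanSpace ℝ (Fin Di),
          MeasureTheory.Integrable (fun θ => MeanFieldBNN.network φ θ x) Q ∧
          MeasureTheory.Integrable (fun θ => MeanFieldBNN.network φ θ x') Q ∧
          ‖(∫ θ, MeanFieldBNN.network φ θ x ∂Q) - ∫ θ, MeanFieldBNN.network φ θ x' ∂Q‖
            ≤ c₁ * c₂ ^ (L - 1) * (L : ℝ)
              * ((2 * |α| + 2 + (‖x‖ + ‖x'‖) / √(Di : ℝ)) / √(M : ℝ))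
              * MeanFieldBNN.klPrior Q
              * max ((2 * MeanFieldBNN.klPrior Q) ^ (((L : ℝ) - 1) / 2)) 1) := by
  -- `c₁ = 2` comes from `K² = 2 KL`, `c₂ = 2` from bounding `(1 + K)^(L-1)`.
  refine ⟨2, 2, by norm_num, by norm_num, by norm_num, by norm_num, ?_⟩
  rintro Di M Do L - hM hL φ α hφ hα Q ⟨m, v, hv, rfl⟩
  have hmain := MeanFieldBNN.networkTilde_bound (m := m) hM hL hv hφ hα
  have haff := MeanFieldBNN.integrable_finalAffine (m := m) (v := v) (α := α)
  have hnet : ∀ x, Integrable (fun θ => MeanFieldBNN.network φ θ x)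
      (MeanFieldBNN.diagGaussian m v) := fun x => by
    simp only [MeanFieldBNN.network_eq_networkTilde_add (α := α)]
    exact (hmain x).1.add haff
  refine ⟨MeanFieldBNN.klDiv_pi_gaussianReal_ne_top m hv, hmain,
    fun x x' => ⟨hnet x, hnet x', ?_⟩⟩
  simp only [MeanFieldBNN.network_eq_networkTilde_add (α := α)]
  -- The final affine term does not involve the input, so it cancels in the difference.
  rw [integral_add (hmain x).1 haff, integral_add (hmain x').1 haff, add_sub_add_right_eq_sub]
  refine (norm_sub_le _ _).trans ((add_le_add (hmain x).2 (hmain x').2).trans_eq ?_)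
  ring
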